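/- **Definitions.** Circuits are Boolean circuits over the gates AND, OR, NOT and constants, with fan-in at most two; the size of a circuit is its number of gates. The truth table of $f:\{0,1\}^j\to\{0,1\}$ is the string of length $2^j$ listing the values of $f$ in lexicographic order. The function encoded by a string $T$ is the function $f_T$ on $\lceil\log_2|T|\rceil$ bits whose truth table is $T$ padded with zeros to length $2^{\lceil\log_2|T|\rceil}$. An $\mathsf{RTIME}[2^{O(n)}]$ *predicate* for a language $L\subseteq\{0,1\}^*$ is a function $V(x,y)$ together with an integer $k\ge 1$ such that, for $x$ of length $n$ and $y\in\{0,1\}^{2^{kn}}$, $V(x,y)$ is computed by a deterministic Turing machine in time $2^{O(n)}$; if $x\in L$ then $\Pr_{y\in\{0,1\}^{2^{kn}}}[V(x,y)=1]\ge 2/3$; and if $x\notin L$ then $V(x,y)=0$ for all $y\in\{0,1\}^{2^{kn}}$. A string $T$ of length $m\cdot 2^{kn}$, broken into $y_1,\dots,y_m$ of length $2^{kn}$, *encodes a hitting set of size $m$ for $V$ on $n$* if for every $x\in L$ of length $n$ there is an $i$ with $V(x,y_i)=1$. For $h:\mathbb N\to\mathbb N$ and $c\in\mathbb N$, we say that $\mathsf{RTIME}[2^{O(n)}]$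 *has $h(n)$-size hitting sets encoded by $n^c$-size circuits* if for every $\mathsf{RTIME}[2^{O(n)}]$ predicate $V$ there is a family of circuits $\{C_n\}$ such that for all but finitely many $n$, $C_n$ has size at most $n^c$ and its truth table encodes a hitting set of size at most $h(n)$ for $V$ on $n$. A set $\mathcal P\subseteq\{0,1\}^*$ is an *io-$\mathsf P$-natural property useful against $n^c$-size circuits* if $\mathcal P$ is decidable in polynomial time, and there is a constant $d$ such that for infinitely many $N$ both of the following hold: $\mathcal P$ contains at least a $1/N^d$ fraction of the strings of length $N$; and $\mathcal P$ contains no string $T$ of length $N$ for which $f_T$ has a circuit of size at most $\lceil\log_2 N\rceil^c$. **Theorem.** Let $A\ge 1$ be an integer (the constant in "$O(n^2)$"). Suppose that for every $c\in\mathbb N$, $\mathsf{RTIME}[2^{O(n)}]$ does not have $A n^2$-size hitting sets encoded by $n^c$-size circuits. Then for every $c\in\mathbb N$ there is an io-$\mathsf P$-natural property useful against $n^c$-size circuits. -/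

import Mathlib

/-! ### Boolean circuits -/

/-- A gate whose arguments are chosen among `w` already available wires. -/
inductive Gate (w : ℕ) : Type
  | const (b : Bool) : Gate w
  | not (i : Fin w) : Gate w
  | and (i j : Fin w) : Gate w
  | or (i j : Fin w) : Gate w

/-- The value of a gate, given the values of the available wires. -/
def Gate.eval {w : ℕ} (v : Fin w → Bool) : Gate w → Bool
  | .const b => b
  | .not i => !(v i)
  | .and i j => v i && v j
  | .or i j => v i || v j

/-- `Circuit n s`: Boolean circuits with `n` inputs and exactly `s` gates, the gates being listed
in topological order. The wires are the `n` inputs followed by the outputs of the `s` gates; gates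
have fan-in at most two and unbounded fan-out. -/
inductive Circuit (n : ℕ) : ℕ → Type
  | inputs : Circuit n 0
  | snoc {s : ℕ} (C : Circuit n s) (g : Gate (n + s)) : Circuit n (s + 1)

/-- The values of all wires of a circuit on input `x`. -/
def Circuit.wires {n : ℕ} : {s : ℕ} → Circuit n s → (Fin n → Bool) → Fin (n + s) → Bool
  | _, .inputs, x => x
  | _, .snoc C g, x => Fin.snoc (α := fun _ => Bool) (C.wires x) (g.eval (C.wires x))

/-- The Boolean function `f` is computed by a circuit with at most `s` gates (one of the wires of
the circuit being designated as its output). -/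
def HasCircuitOfSize {n : ℕ} (f : (Fin n → Bool) → Bool) (s : ℕ) : Prop :=
  ∃ t ≤ s, ∃ (C : Circuit n t) (out : Fin (n + t)), ∀ x, C.wires x out = f x

/-! ### Truth tables -/

/-- The `i`-th string of length `n` in lexicographic order, for `i < 2 ^ n`
(most significant bit first). -/
def lexString (n i : ℕ) : Fin n → Bool := fun q => i.testBit (n - 1 - q)

/-- The truth table of `f`: its values on all strings of length `n` in lexicographic order. -/
def truthTable {n : ℕ} (f : (Fin n → Bool) → Bool) : List Bool :=
  List.ofFn fun i : Fin (2 ^ n) => f (lexString n i)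

/-- `f` is the function encoded by the string `T`: it has `⌈log₂ |T|⌉` inputs, and its truth table
is `T` followed by as many zeros as are needed to reach length `2 ^ ⌈log₂ |T|⌉`. -/
def IsEncodedBy (T : List Bool) (f : (Fin (Nat.clog 2 T.length) → Bool) → Bool) : Prop :=
  truthTable f = T ++ List.replicate (2 ^ Nat.clog 2 T.length - T.length) false

/-- The circuit complexity of the string `T` is at most `s`. -/
def StringHasCircuitOfSize (T : List Bool) (s : ℕ) : Prop :=
  ∃ f, IsEncodedBy T f ∧ HasCircuitOfSize f s

/-! ### Predicates of `RTIME[2^{O(n)}]` -/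

/-- The fraction of the strings of length `ℓ` that `A` accepts. -/
def acceptFraction (ℓ : ℕ) (A : List Bool → Bool) : ℚ :=
  ((Finset.univ.filter fun y : Fin ℓ → Bool => A (List.ofFn y) = true).card : ℚ) / 2 ^ ℓ

/-- `V(x, y)` is computed on all `x` and all `y` of length `2 ^ (k |x|)` by one Turing machine in
time `2 ^ O(|x|)`. The input of the machine is the pair `(x, y)`, written as the symbols of `x`
followed by those of `y`, over two disjoint copies of the binary alphabet. -/
def RunsInExpTime (V : List Bool → List Bool → Bool) (k : ℕ) : Prop :=
  ∃ (M : Turing.TM2ComputableAux (Bool ⊕ Bool) Bool) (a : ℕ),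
    ∀ x y : List Bool, y.length = 2 ^ (k * x.length) →
      Nonempty (Turing.TM2OutputsInTime M.tm
        (((Computability.encodingProd (Computability.encodingList Bool)
          (Computability.encodingList Bool)).encode (x, y)).map M.inputAlphabet.invFun)
        (some ((Computability.encodeBool (V x y)).map M.outputAlphabet.invFun))
        (a * 2 ^ (a * x.length)))

/-- `V` is an `RTIME[2^{O(n)}]` predicate accepting the language `L`, using `2 ^ (k n)` random bits
on inputs of length `n`: it runs in time `2 ^ O(n)`, it accepts every `x ∈ L` with probability at
least `2/3`, and it never accepts an `x ∉ L`. -/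
structure IsRTimePredicate (V : List Bool → List Bool → Bool) (L : Language Bool) (k : ℕ) :
    Prop where
  pos : 1 ≤ k
  time : RunsInExpTime V k
  complete : ∀ x ∈ L, 2 / 3 ≤ acceptFraction (2 ^ (k * x.length)) (V x)
  sound : ∀ x ∉ L, ∀ y : List Bool, y.length = 2 ^ (k * x.length) → V x y = false

/-! ### Hitting sets -/

/-- `S` is a hitting set for the predicate `V` (accepting `L`) on length `n`. -/
def IsHittingSet (V : List Bool → List Bool → Bool) (L : Language Bool) (n : ℕ)
    (S : Set (List Bool)) : Prop :=
  ∀ x ∈ L, x.length = n → ∃ y ∈ S, V x y = true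

/-- The string `T` has length `m * 2 ^ (k n)`, and the `m` strings of length `2 ^ (k n)` into which
it can be broken form a hitting set for `V` on length `n`. -/
def EncodesHittingSet (V : List Bool → List Bool → Bool) (L : Language Bool) (k n m : ℕ)
    (T : List Bool) : Prop :=
  T.length = m * 2 ^ (k * n) ∧
    IsHittingSet V L n
      {y | ∃ i < m, y = (T.drop (i * 2 ^ (k * n))).take (2 ^ (k * n))}

/-- `RTIME[2^{O(n)}]` has hitting sets of size at most `h n` encoded by circuits of size `n ^ c`:
for each predicate there is a family of circuits `C n` with at most `n ^ c` gates such that, for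
almost all `n`, the truth table of `C n` encodes a hitting set of at most `h n` strings for the
predicate on length `n`. -/
def RTimeHasHittingSets (h : ℕ → ℕ) (c : ℕ) : Prop :=
  ∀ (V : List Bool → List Bool → Bool) (L : Language Bool) (k : ℕ), IsRTimePredicate V L k →
    ∀ᶠ n in Filter.atTop, ∃ (j : ℕ) (f : (Fin j → Bool) → Bool), HasCircuitOfSize f (n ^ c) ∧
      ∃ m ≤ h n, EncodesHittingSet V L k n m (truthTable f)

/-! ### Natural properties -/

/-- The property `P` of strings (i.e. of truth tables of Boolean functions) is decidable in
polynomial time by a Turing machine. -/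
def IsPolyTimeProperty (P : List Bool → Bool) : Prop :=
  Nonempty (Turing.TM2ComputableInPolyTime (Computability.encodingList Bool).encode
    Computability.encodeBool P)

/-- `P` is an io-P-natural property useful against circuits of size `n ^ c`: it is decidable in
polynomial time, and for infinitely many `N` simultaneously `P` accepts at least a `1 / poly(N)`
fraction of the strings of length `N`, and `P` rejects all strings of length `N` that encode
functions, on `⌈log₂ N⌉` inputs, with circuits of size `⌈log₂ N⌉ ^ c`. -/
structure IsIoPNatural (P : List Bool → Bool) (c : ℕ) : Prop where
  constructive : IsPolyTimeProperty P
  large_and_useful : ∃ d : ℕ, ∃ᶠ N : ℕ in Filter.atTop,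
    1 / (N : ℚ) ^ d ≤ acceptFraction N P ∧
    ∀ T : List Bool, T.length = N → StringHasCircuitOfSize T (Nat.clog 2 N ^ c) → P T = false

/-! Fix `c` and take a predicate `V` for which hitting sets given by circuits of size `n ^ (c + 1)`
fail at infinitely many `n`. At such `n`, a truth table of at most `A * n ^ 2` blocks that is a
hitting set must be hard, while a random string of at least `n` blocks is a hitting set with
probability at least 1/2. So "hits every `x ∈ L` of length `n`" would be a natural property, if only
it could be decided.

The error of `V` is one-sided: whatever is hit lies in `L` (`hitsFrom_subset_census`). Hence a
string hits all of `L` at length `n` as soon as it hits the right number of inputs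
(`censusProperty_iff`), and this number is the only missing information. It needs about `n` bits,
and the length `N` of the string can carry them: from the most significant bit on, `N` reads 1, some
zeros, 1, and then the `n`-bit number `2 ^ n` minus the census. `censusProperty` decodes this
deficit, adds one for each input hit, and accepts when the sum reaches `2 ^ n`. It takes polynomial
time at every length, because the decoded `n` satisfies `2 ^ n ≤ N + 1`; the Turing machine showing
this fills most of the file (`steps_machine`).

The number of zeros places `N` between `2 ^ (ℓ + 1)` and `2 ^ (ℓ + 2)` blocks, where `2 ^ ℓ < n ≤ 2
^ (ℓ + 1)`. The lower bound gives largeness, by independence of the blocks and a union bound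
(`half_le_acceptFraction_censusProperty`). The upper bound gives usefulness: padded to a full truth
table, an accepted string encodes a hitting set of `2 ^ (ℓ + 2) ≤ n ^ 2` blocks
(`encodesHittingSet_truthTable`), so a small circuit for it would contradict the choice of `n`. -/

open Turing

/-! ### Reachability within a number of steps -/

/-- Iterating the partial function `f` at most `t` times leads from `a` to `b`. -/
def ReachesIn {α : Type*} (f : α → Option α) (t : ℕ) (a b : α) : Prop :=
  ∃ s ≤ t, (flip bind f)^[s] (some a) = some b

namespace ReachesIn

variable {α : Type*} {f : α → Option α} {t t₁ t₂ : ℕ} {a b c : α}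

theorem mono (h : ReachesIn f t₁ a b) (ht : t₁ ≤ t₂) : ReachesIn f t₂ a b := by
  obtain ⟨s, hs, h⟩ := h
  exact ⟨s, hs.trans ht, h⟩

theorem trans (h₁ : ReachesIn f t₁ a b) (h₂ : ReachesIn f t₂ b c) :
    ReachesIn f (t₁ + t₂) a c := by
  obtain ⟨s₁, hs₁, h₁⟩ := h₁
  obtain ⟨s₂, hs₂, h₂⟩ := h₂
  exact ⟨s₂ + s₁, by omega, by rw [Function.iterate_add_apply, h₁, h₂]⟩

theorem single (h : f a = some b) : ReachesIn f 1 a b := ⟨1, le_rfl, h⟩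

theorem head (h : f a = some b) (h' : ReachesIn f t b c) : ReachesIn f (t + 1) a c :=
  ((single h).trans h').mono (by omega)

theorem cons {c' : α} {t' : ℕ} (h' : ReachesIn f t b c) (h : f a = some b) (hc : c = c')
    (ht : t + 1 ≤ t') : ReachesIn f t' a c' := hc ▸ (head h h').mono ht

/-- A map that commutes with the steps preserves reachability. -/
theorem map {β : Type*} {g : β → Option β} (φ : α → β)
    (hφ : ∀ a a', f a = some a' → g (φ a) = some (φ a')) (h : ReachesIn f t a b) :
    ReachesIn g t (φ a) (φ b) := by
  obtain ⟨s, hs, h⟩ := h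
  refine ⟨s, hs, ?_⟩
  clear hs
  induction s generalizing a with
  | zero =>
    simp only [Function.iterate_zero, id_eq, Option.some.injEq] at h ⊢
    rw [h]
  | succ s ih =>
    rw [Function.iterate_succ_apply] at h ⊢
    have hf : flip bind f (some a) = f a := rfl
    have hg : flip bind g (some (φ a)) = g (φ a) := rfl
    rw [hf] at h
    rw [hg]
    cases hfa : f a with
    | none =>
      rw [hfa] at h
      have : ∀ n, (flip bind f)^[n] none = (none : Option α) := by
        intro n
        exact Function.iterate_fixed rfl n
      rw [this] at h
      simp at h
    | some a' =>
      rw [hfa] at h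
      rw [hφ a a' hfa]
      exact ih h

end ReachesIn

/-! ### The machine counting the inputs that are hit -/

/-- The work stacks of the census machine. -/
inductive WorkStack
  | text | done | block | aux | length | time | deficit | query
  deriving DecidableEq

/-- The list of all work stacks. -/
def WorkStack.all : List WorkStack :=
  [text, done, block, aux, length, time, deficit, query]

theorem WorkStack.mem_all (s : WorkStack) : s ∈ WorkStack.all := by cases s <;> decide

instance : Fintype WorkStack := Fintype.ofList _ WorkStack.mem_all

/-- The labels of the census machine, apart from those of its subroutine. -/
inductive WorkLabel
  | copy
  | carry (s : WorkStack)
  | back (s : WorkStack) (overflow : Bool)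
  | reverse
  | skipOne
  | skipZeros
  | setup
  | rewind (next : Option WorkStack)
  | blockStart
  | readSymbol
  | feedBlock
  | saveQuery
  | feedQuery
  | ret
  | clean (answer : Bool)
  deriving Fintype

namespace Census

open WorkStack WorkLabel TM2.Stmt

variable (M : FinTM2) (e₀ : M.Γ M.k₀ ≃ Bool ⊕ Bool) (e₁ : M.Γ M.k₁ ≃ Bool) (k : ℕ)

/-- The stack alphabets of the census machine. -/
abbrev Alphabet : M.K ⊕ WorkStack → Type := Sum.elim M.Γ fun _ => Bool

/-- The statements of the census machine. -/
abbrev CStmt : Type := TM2.Stmt (Alphabet M) (WorkLabel ⊕ M.Λ) (M.σ × Option Bool)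

/-- The configurations of the census machine. -/
abbrev CCfg : Type := TM2.Cfg (Alphabet M) (WorkLabel ⊕ M.Λ) (M.σ × Option Bool)

variable {M}

/-- Jump to a label of the census machine. -/
def jump (l : WorkLabel) : CStmt M := goto fun _ => Sum.inl l

/-- Push a fixed bit on a work stack. -/
def pushBit (s : WorkStack) (b : Bool) (q : CStmt M) : CStmt M :=
  push (Sum.inr s) (fun _ => (b : Bool)) q

/-- Push several copies of a bit on a work stack. -/
def pushBits (s : WorkStack) (b : Bool) : ℕ → CStmt M → CStmt M
  | 0, q => q
  | n + 1, q => pushBit s b (pushBits s b n q)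

/-- Branch on the bit stored in the internal state, and forget it. -/
def branchBit (onBit : Bool → CStmt M) (onNone : CStmt M) : CStmt M :=
  branch (fun v => v.2.isNone) onNone
    (branch (fun v => v.2 == some true) (load (fun v => (v.1, none)) (onBit true))
      (load (fun v => (v.1, none)) (onBit false)))

/-- Pop a bit from a work stack, and branch on it. -/
def popBit (s : WorkStack) (onBit : Bool → CStmt M) (onNone : CStmt M) : CStmt M :=
  pop (Sum.inr s) (fun v (o : Option Bool) => (v.1, o)) (branchBit onBit onNone)

/-- Pop a symbol from each of the given work stacks until one of them turns out to be nonempty. -/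
def drain (again last : CStmt M) : List WorkStack → CStmt M
  | [] => last
  | s :: l => popBit s (fun _ => again) (drain again last l)

/-- The label at which the machine goes on after incrementing a counter. -/
def afterIncrement : WorkStack → Bool → WorkLabel
  | .length, _ => copy
  | .time, true => feedBlock
  | .time, false => readSymbol
  | .deficit, true => clean true
  | .deficit, false => carry query
  | .query, false => blockStart
  | _, _ => clean false

/-- The program of the census machine, apart from that of its subroutine. -/
def program : WorkLabel → CStmt M
  | copy => popBit text (fun b => pushBit done b (jump (carry .length))) (jump reverse)
  | carry s => popBit s
      -- The ones passed by the carry become zeros, parked on `aux` until `back` returns them.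
      (fun b => if b then pushBit aux false (jump (carry s))
        else pushBit s true (jump (back s false)))
      -- Only the counter of the input length may grow; the others have fixed width, and their
      -- overflow serves as a signal.
      (if s = .length then pushBit s true (jump (back s true)) else jump (back s true))
  | back s o => popBit aux (fun b => pushBit s b (jump (back s o))) (jump (afterIncrement s o))
  | reverse => popBit .length (fun b => pushBit aux b (jump reverse)) (jump skipOne)
  | skipOne => popBit aux (fun _ => jump skipZeros) (jump skipZeros)
  | skipZeros => popBit aux (fun b => if b then jump setup else jump skipZeros) (jump setup)
  | setup => popBit aux
      (fun b => pushBit deficit b (pushBit query false (pushBits time false k (jump setup))))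
      (jump (rewind none))
  | rewind o => popBit done (fun b => pushBit text b (jump (rewind o)))
      (jump (o.elim blockStart carry))
  | blockStart => popBit text (fun b => pushBit text b (jump readSymbol))
      (jump (rewind (some query)))
  | readSymbol => popBit text
      (fun b => pushBit done b (pushBit block b (jump (carry time))))
      -- The text may end within a block, which is then padded with zeros, as in `firstBlock`.
      (pushBit block false (jump (carry time)))
  | feedBlock => popBit block
      (fun b => push (Sum.inl M.k₀) (fun _ => e₀.symm (Sum.inr b)) (jump feedBlock))
      (jump saveQuery)
  | saveQuery => popBit query (fun b => pushBit aux b (jump saveQuery)) (jump feedQuery)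
  | feedQuery => popBit aux
      (fun b => pushBit query b
        (push (Sum.inl M.k₀) (fun _ => e₀.symm (Sum.inl b)) (jump feedQuery)))
      (goto fun _ => Sum.inr M.main)
  | ret => pop (Sum.inl M.k₁) (fun v (o : Option (M.Γ M.k₁)) => (v.1, o.map e₁))
      (branchBit (fun b => if b then jump (rewind (some deficit)) else jump blockStart)
        (jump blockStart))
  | clean b => drain (jump (clean b)) (pushBit text b halt) WorkStack.all

/-- A statement of the subroutine, as a statement of the census machine. -/
def embed : TM2.Stmt M.Γ M.Λ M.σ → CStmt M
  | push i f q => push (Sum.inl i) (fun v => f v.1) (embed q)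
  | peek i f q => peek (Sum.inl i) (fun v (o : Option (M.Γ i)) => (f v.1 o, v.2)) (embed q)
  | pop i f q => pop (Sum.inl i) (fun v (o : Option (M.Γ i)) => (f v.1 o, v.2)) (embed q)
  | load f q => load (fun v => (f v.1, v.2)) (embed q)
  | branch f q₁ q₂ => branch (fun v => f v.1) (embed q₁) (embed q₂)
  | goto f => goto fun v => Sum.inr (f v.1)
  | halt => jump ret

/-- The statements of the census machine. -/
def code : WorkLabel ⊕ M.Λ → CStmt M := Sum.elim (program e₀ e₁ k) fun l => embed (M.m l)

/-- The machine which decodes a number `n` and a bit string of length `n` from the length of its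
input, increments that bit string for every `x` of length `n` such that the subroutine `M` accepts
`x` together with some block of the input, and accepts if there is an overflow. -/
def machine (M : FinTM2) (e₀ : M.Γ M.k₀ ≃ Bool ⊕ Bool) (e₁ : M.Γ M.k₁ ≃ Bool) (k : ℕ) :
    FinTM2 where
  K := M.K ⊕ WorkStack
  kDecidableEq := inferInstance
  kFin := letI := M.kFin; inferInstance
  k₀ := Sum.inr text
  k₁ := Sum.inr text
  Γ := Alphabet M
  Λ := WorkLabel ⊕ M.Λ
  main := Sum.inl copy
  ΛFin := letI := M.ΛFin; inferInstance
  σ := M.σ × Option Bool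
  initialState := (M.initialState, none)
  σFin := letI := M.σFin; inferInstance
  Γk₀Fin := inferInstanceAs (Fintype Bool)
  m := code e₀ e₁ k

/-- The stacks of the census machine, from those of the subroutine and the work stacks. -/
def join (μ : ∀ i, List (M.Γ i)) (S : WorkStack → List Bool) : ∀ i, List (Alphabet M i)
  | Sum.inl i => μ i
  | Sum.inr s => S s

@[simp] theorem join_inl (μ : ∀ i, List (M.Γ i)) (S : WorkStack → List Bool) (i : M.K) :
    join μ S (Sum.inl i) = μ i := rfl

@[simp] theorem join_inr (μ : ∀ i, List (M.Γ i)) (S : WorkStack → List Bool) (s : WorkStack) :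
    join μ S (Sum.inr s) = S s := rfl

theorem update_join_inl (μ : ∀ i, List (M.Γ i)) (S : WorkStack → List Bool) (i : M.K)
    (l : List (M.Γ i)) :
    Function.update (join μ S) (Sum.inl i) l = join (Function.update μ i l) S := by
  funext j
  rcases j with j | j
  · by_cases h : j = i
    · subst h
      change _ = Function.update μ j l j
      rw [Function.update_self]
      exact Function.update_self ..
    · exact (Function.update_of_ne (by simpa using h) ..).trans
        (Function.update_of_ne h ..).symm
  · exact Function.update_of_ne (by simp) ..

theorem update_join_inr (μ : ∀ i, List (M.Γ i)) (S : WorkStack → List Bool) (s : WorkStack)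
    (l : List Bool) :
    Function.update (join μ S) (Sum.inr s) l = join μ (Function.update S s l) := by
  funext j
  rcases j with j | j
  · exact Function.update_of_ne (by simp) ..
  · by_cases h : j = s
    · subst h
      change _ = Function.update S j l j
      rw [Function.update_self]
      exact Function.update_self ..
    · exact (Function.update_of_ne (by simpa using h) ..).trans
        (Function.update_of_ne h ..).symm

/-- The configuration of the census machine at one of its own labels. -/
def cfg (l : WorkLabel) (μ : ∀ i, List (M.Γ i)) (S : WorkStack → List Bool) : CCfg M :=
  ⟨some (Sum.inl l), (M.initialState, none), join μ S⟩

/-- The configuration of the census machine during a run of the subroutine. -/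
def lift (S : WorkStack → List Bool) (c : M.Cfg) : CCfg M :=
  ⟨some (c.l.elim (Sum.inl ret) Sum.inr), (c.var, none), join c.stk S⟩

/-! ### Effect of the statements on configurations -/

variable {e₀ e₁ k}

theorem stepAux_embed (S : WorkStack → List Bool) (q : TM2.Stmt M.Γ M.Λ M.σ) (v : M.σ)
    (μ : ∀ i, List (M.Γ i)) :
    TM2.stepAux (embed q) (v, none) (join μ S) = lift S (TM2.stepAux q v μ) := by
  induction q generalizing v μ with
  | push i f q ih =>
    simp only [embed, TM2.stepAux]
    rw [← ih]
    congr 1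
    exact update_join_inl ..
  | peek i f q ih =>
    simp only [embed, TM2.stepAux]
    exact ih ..
  | pop i f q ih =>
    simp only [embed, TM2.stepAux]
    rw [← ih]
    congr 1
    exact update_join_inl ..
  | load f q ih =>
    simp only [embed, TM2.stepAux]
    exact ih ..
  | branch f q₁ q₂ ih₁ ih₂ =>
    simp only [embed, TM2.stepAux]
    cases f v
    · exact ih₂ ..
    · exact ih₁ ..
  | goto f => rfl
  | halt => rfl

/-- The subroutine never touches the work stacks or the extra bit of the state, so its runs carry
over step by step, halting being replaced by a jump to `ret`. -/
theorem reachesIn_lift (S : WorkStack → List Bool) {t : ℕ} {c c' : M.Cfg}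
    (h : ReachesIn M.step t c c') :
    ReachesIn (TM2.step (code e₀ e₁ k)) t (lift S c) (lift S c') := by
  refine h.map _ ?_
  rintro ⟨l, v, μ⟩ a' ha
  cases l with
  | none => simp [TM2.step] at ha
  | some l =>
    obtain rfl : TM2.stepAux (M.m l) v μ = a' := Option.some.inj ha
    exact congrArg some (stepAux_embed ..)

theorem step_cfg (l : WorkLabel) (μ : ∀ i, List (M.Γ i)) (S : WorkStack → List Bool) :
    TM2.step (code e₀ e₁ k) (cfg l μ S) =
      some (TM2.stepAux (program e₀ e₁ k l) (M.initialState, none) (join μ S)) := rfl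

@[simp] theorem stepAux_jump (l : WorkLabel) (μ : ∀ i, List (M.Γ i))
    (S : WorkStack → List Bool) :
    TM2.stepAux (jump l) (M.initialState, none) (join μ S) = cfg l μ S := rfl

@[simp] theorem stepAux_pushBit (s : WorkStack) (b : Bool) (q : CStmt M) (v : M.σ × Option Bool)
    (μ : ∀ i, List (M.Γ i)) (S : WorkStack → List Bool) :
    TM2.stepAux (pushBit s b q) v (join μ S) =
      TM2.stepAux q v (join μ (Function.update S s (b :: S s))) := by
  rw [← update_join_inr]
  rfl

@[simp] theorem stepAux_push_inl (i : M.K) (f : M.σ × Option Bool → M.Γ i) (q : CStmt M)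
    (v : M.σ × Option Bool) (μ : ∀ i, List (M.Γ i)) (S : WorkStack → List Bool) :
    TM2.stepAux (push (Sum.inl i) f q : CStmt M) v (join μ S) =
      TM2.stepAux q v (join (Function.update μ i (f v :: μ i)) S) := by
  rw [← update_join_inl]
  rfl

theorem stepAux_branchBit (onBit : Bool → CStmt M) (onNone : CStmt M) (v : M.σ)
    (o : Option Bool) (μ : ∀ i, List (M.Γ i)) (S : WorkStack → List Bool) :
    TM2.stepAux (branchBit onBit onNone) (v, o) (join μ S) =
      TM2.stepAux (o.elim onNone onBit) (v, none) (join μ S) := by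
  rcases o with _ | _ | _ <;> rfl

@[simp] theorem stepAux_popBit (s : WorkStack) (onBit : Bool → CStmt M) (onNone : CStmt M)
    (v : M.σ) (μ : ∀ i, List (M.Γ i)) (S : WorkStack → List Bool) :
    TM2.stepAux (popBit s onBit onNone) (v, none) (join μ S) =
      TM2.stepAux ((S s).head?.elim onNone onBit) (v, none)
        (join μ (Function.update S s (S s).tail)) := by
  rw [← stepAux_branchBit, ← update_join_inr]
  rfl

theorem stepAux_pushBits (s : WorkStack) (b : Bool) (n : ℕ) (q : CStmt M)
    (v : M.σ × Option Bool) (μ : ∀ i, List (M.Γ i)) (S : WorkStack → List Bool) :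
    TM2.stepAux (pushBits s b n q) v (join μ S) =
      TM2.stepAux q v (join μ (Function.update S s (List.replicate n b ++ S s))) := by
  induction n generalizing S with
  | zero => simp [pushBits]
  | succ n ih =>
    rw [pushBits, stepAux_pushBit, ih]
    simp only [Function.update_self, Function.update_idem]
    rw [List.replicate_succ', List.append_assoc, List.singleton_append]

end Census

/-! ### Binary counters -/

/-- Increment a binary number, least significant bit first; on overflow, the number is extended
by a bit if `extend` is set, and wraps around to zero otherwise. -/
def incrementBits (extend : Bool) : List Bool → List Bool
  | [] => if extend then [true] else []
  | false :: l => true :: l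
  | true :: l => false :: incrementBits extend l

/-- The `n` least significant bits of a number, least significant bit first. -/
def lowBits : ℕ → ℕ → List Bool
  | 0, _ => []
  | n + 1, v => v.bodd :: lowBits n v.div2

/-- The number written as a list of bits, least significant bit first. -/
def bitsValue : List Bool → ℕ
  | [] => 0
  | b :: l => Nat.bit b (bitsValue l)

@[simp] theorem length_lowBits (n v : ℕ) : (lowBits n v).length = n := by
  induction n generalizing v with
  | zero => rfl
  | succ n ih => simp [lowBits, ih]

theorem lowBits_zero (n : ℕ) : lowBits n 0 = List.replicate n false := by
  induction n with
  | zero => rfl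
  | succ n ih =>
    change Nat.bodd 0 :: lowBits n (Nat.div2 0) = _
    rw [Nat.div2_zero, ih]
    rfl

theorem lowBits_bitsValue (l : List Bool) : lowBits l.length (bitsValue l) = l := by
  induction l with
  | nil => rfl
  | cons b l ih => simp [lowBits, bitsValue, ih]

theorem bitsValue_lt (l : List Bool) : bitsValue l < 2 ^ l.length := by
  induction l with
  | nil => simp [bitsValue]
  | cons b l ih =>
    simp only [bitsValue, List.length_cons, Nat.bit_val, pow_succ]
    cases b <;> simp <;> omega

theorem bitsValue_lowBits {n v : ℕ} (hv : v < 2 ^ n) : bitsValue (lowBits n v) = v := by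
  induction n generalizing v with
  | zero => simp [lowBits, bitsValue] at hv ⊢; omega
  | succ n ih =>
    rw [lowBits, bitsValue, ih, Nat.bit_bodd_div2]
    rw [Nat.div2_val]
    omega

theorem lowBits_succ (n v : ℕ) : lowBits n (v + 1) = incrementBits false (lowBits n v) := by
  induction n generalizing v with
  | zero => rfl
  | succ n ih =>
    rcases Nat.even_or_odd' v with ⟨w, rfl | rfl⟩
    · have h₁ : (2 * w).bodd = false := by simp
      have h₂ : (2 * w + 1).bodd = true := by simp
      have h₃ : (2 * w).div2 = w := by rw [Nat.div2_val]; omega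
      have h₄ : (2 * w + 1).div2 = w := by rw [Nat.div2_val]; omega
      simp only [lowBits, h₁, h₂, h₃, h₄, incrementBits]
    · have h₁ : (2 * w + 1 + 1).bodd = false := by simp
      have h₂ : (2 * w + 1).bodd = true := by simp
      have h₃ : (2 * w + 1 + 1).div2 = w + 1 := by rw [Nat.div2_val]; omega
      have h₄ : (2 * w + 1).div2 = w := by rw [Nat.div2_val]; omega
      simp only [lowBits, h₁, h₂, h₃, h₄, incrementBits, ih]

/-- A counter of fixed width overflows exactly when all its bits are ones. -/
theorem all_lowBits (n v : ℕ) : (lowBits n v).all id = true ↔ 2 ^ n ∣ v + 1 := by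
  induction n generalizing v with
  | zero => simp [lowBits]
  | succ n ih =>
    simp only [lowBits, List.all_cons, id_eq, Bool.and_eq_true, ih, pow_succ]
    rcases Nat.even_or_odd' v with ⟨w, rfl | rfl⟩
    · simp only [Nat.bodd_mul, Nat.bodd_two, Bool.false_and, Bool.false_eq_true, false_and,
        false_iff]
      intro h
      have := (Dvd.intro_left _ rfl : 2 ∣ 2 ^ n * 2).trans h
      omega
    · have h₄ : (2 * w + 1).div2 = w := by rw [Nat.div2_val]; omega
      rw [h₄]
      have h₂ : (2 * w + 1).bodd = true := by simp
      rw [h₂, show 2 * w + 1 + 1 = (w + 1) * 2 by ring, Nat.mul_dvd_mul_iff_right (by norm_num)]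
      simp

theorem bits_succ (n : ℕ) : (n + 1).bits = incrementBits true n.bits := by
  induction n using Nat.binaryRec' with
  | zero => simp [incrementBits]
  | bit b n hb ih =>
    rw [Nat.bits_append_bit _ _ hb]
    cases b with
    | false =>
      have : Nat.bit false n + 1 = Nat.bit true n := by simp [Nat.bit_val]
      rw [this, Nat.bits_append_bit _ _ (by simp)]
      rfl
    | true =>
      have : Nat.bit true n + 1 = Nat.bit false (n + 1) := by simp [Nat.bit_val]; ring
      rw [this, Nat.bits_append_bit _ _ (by simp), ih]
      rfl

theorem length_bits_le (n : ℕ) : n.bits.length ≤ n := by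
  rw [Nat.size_eq_bits_len]
  exact Nat.size_le.2 Nat.lt_two_pow_self

/-! ### The advice encoded by the length of a string -/

/-- The part of a string that follows its first one. -/
def afterOne : List Bool → List Bool
  | [] => []
  | true :: l => l
  | false :: l => afterOne l

theorem length_afterOne_le (l : List Bool) : (afterOne l).length ≤ l.length := by
  induction l with
  | nil => simp [afterOne]
  | cons b l ih => cases b <;> simp [afterOne]; omega

/-- The string that follows the second one in the binary expansion of `N`, reversed. -/
def advice (N : ℕ) : List Bool := (afterOne N.bits.reverse.tail).reverse

theorem length_advice_le (N : ℕ) : (advice N).length ≤ N.size - 1 := by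
  rw [← Nat.size_eq_bits_len, advice, List.length_reverse]
  exact (length_afterOne_le _).trans (by simp)

/-- Valid for every `N`, including those that encode nothing meaningful; this keeps the machine
polynomial on all inputs. -/
theorem two_pow_length_advice_le (N : ℕ) : 2 ^ (advice N).length ≤ N + 1 := by
  have h := length_advice_le N
  rcases Nat.eq_zero_or_pos N.size with h0 | h0
  · have : (advice N).length = 0 := by omega
    simp [this]
  · have : (advice N).length < N.size := by omega
    exact (Nat.lt_size.1 this).trans (Nat.le_succ _)

/-- The block that the string `t` starts with, padded with zeros to length `m`. -/
abbrev firstBlock (m : ℕ) (t : List Bool) : List Bool := t.takeD m false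

/-- Some block of length `m` of the string `t` is accepted by `p`. -/
def HitsBlock (p : List Bool → Bool) (m : ℕ) (t : List Bool) : Prop :=
  ∃ i, i * m < t.length ∧ p (firstBlock m (t.drop (i * m))) = true

/-- The numbers from `v` on whose `n` bits are a string for which some block of the string `t` is accepted. -/
noncomputable def hitsFrom (V : List Bool → List Bool → Bool) (n m v : ℕ) (t : List Bool) :
    Finset ℕ :=
  open Classical in (Finset.Ico v (2 ^ n)).filter fun w => HitsBlock (V (lowBits n w)) m t

/-- The string `t` hits enough inputs for the number that its length encodes. -/
noncomputable def censusProperty (V : List Bool → List Bool → Bool) (k : ℕ) (t : List Bool) :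
    Bool :=
  let u := advice t.length
  let n := u.length
  decide (2 ^ n ≤ bitsValue u + (hitsFrom V n (2 ^ (k * n)) 0 t).card)

/-! ### Incrementing a counter on a work stack -/

namespace Census

open WorkStack WorkLabel TM2.Stmt

variable {M : FinTM2} {e₀ : M.Γ M.k₀ ≃ Bool ⊕ Bool} {e₁ : M.Γ M.k₁ ≃ Bool} {k : ℕ}

/-- Work stacks with the given contents. -/
def layout (t d b a l m u q : List Bool) : WorkStack → List Bool
  | text => t
  | done => d
  | block => b
  | aux => a
  | .length => l
  | time => m
  | deficit => u
  | query => q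

section layout
variable (t d b a l m u q x : List Bool)

@[simp] theorem layout_text : layout t d b a l m u q text = t := rfl
@[simp] theorem layout_done : layout t d b a l m u q done = d := rfl
@[simp] theorem layout_block : layout t d b a l m u q block = b := rfl
@[simp] theorem layout_aux : layout t d b a l m u q aux = a := rfl
@[simp] theorem layout_length : layout t d b a l m u q .length = l := rfl
@[simp] theorem layout_time : layout t d b a l m u q time = m := rfl
@[simp] theorem layout_deficit : layout t d b a l m u q deficit = u := rfl
@[simp] theorem layout_query : layout t d b a l m u q query = q := rfl

@[simp] theorem update_layout_text :
    Function.update (layout t d b a l m u q) text x = layout x d b a l m u q := by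
  funext s; cases s <;> rfl
@[simp] theorem update_layout_done :
    Function.update (layout t d b a l m u q) done x = layout t x b a l m u q := by
  funext s; cases s <;> rfl
@[simp] theorem update_layout_block :
    Function.update (layout t d b a l m u q) block x = layout t d x a l m u q := by
  funext s; cases s <;> rfl
@[simp] theorem update_layout_aux :
    Function.update (layout t d b a l m u q) aux x = layout t d b x l m u q := by
  funext s; cases s <;> rfl
@[simp] theorem update_layout_length :
    Function.update (layout t d b a l m u q) .length x = layout t d b a x m u q := by
  funext s; cases s <;> rfl
@[simp] theorem update_layout_time :
    Function.update (layout t d b a l m u q) time x = layout t d b a l x u q := by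
  funext s; cases s <;> rfl
@[simp] theorem update_layout_deficit :
    Function.update (layout t d b a l m u q) deficit x = layout t d b a l m x q := by
  funext s; cases s <;> rfl
@[simp] theorem update_layout_query :
    Function.update (layout t d b a l m u q) query x = layout t d b a l m u x := by
  funext s; cases s <;> rfl

end layout

variable (e₀ e₁ k) in
/-- The census machine gets from one configuration to another in at most the given time. -/
abbrev Steps : ℕ → CCfg M → CCfg M → Prop := ReachesIn (TM2.step (code e₀ e₁ k))

/-- The empty stacks of the subroutine. -/
abbrev nothing : ∀ i, List (M.Γ i) := fun _ => []

variable {μ : ∀ i, List (M.Γ i)} (t d b a l m u q x : List Bool)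

theorem steps_back (s : WorkStack) (hs : s ≠ aux) (o : Bool) (S : WorkStack → List Bool)
    (j : ℕ) (h : S aux = List.replicate j false) :
    Steps e₀ e₁ k (j + 1) (cfg (back s o) μ S)
      (cfg (afterIncrement s o) μ
        (Function.update (Function.update S aux []) s (List.replicate j false ++ S s))) := by
  induction j generalizing S with
  | zero =>
    refine ReachesIn.single ?_
    simp only [step_cfg, program, stepAux_popBit, h, List.replicate_zero, List.head?_nil,
      Option.elim_none, stepAux_jump, List.tail_nil, List.nil_append]
    congr 2
    rw [Function.update_comm hs.symm, Function.update_eq_self]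
  | succ j ih =>
    have h₁ := ih (Function.update (Function.update S aux (List.replicate j false)) s
      (false :: S s)) (by simp [hs.symm])
    refine h₁.cons ?_ ?_ le_rfl
    · simp [step_cfg, program, h, List.replicate_succ, hs]
    · congr 1
      funext r
      by_cases hr : r = s
      · simp [hr, List.replicate_succ']
      · by_cases hr' : r = aux <;>
        simp [hr, hr', hs.symm]

/-- Stated in the midst of a carry, with `j` flipped bits already on `aux`, so that induction on the
remaining bits applies. -/
theorem steps_carry (s : WorkStack) (hs : s ≠ aux) (S : WorkStack → List Bool)
    (j : ℕ) (h : S aux = List.replicate j false) (l : List Bool) (hl : S s = l) :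
    Steps e₀ e₁ k (j + 2 * l.length + 2) (cfg (carry s) μ S)
      (cfg (afterIncrement s (l.all id)) μ
        (Function.update (Function.update S aux []) s
          (List.replicate j false ++ incrementBits (s = .length) l))) := by
  induction l generalizing S j with
  | nil =>
    have h₁ := steps_back (μ := μ) (e₀ := e₀) (e₁ := e₁) (k := k) s hs true
      (Function.update S s (if s = .length then [true] else [])) j
      (by simp [hs.symm, h])
    refine h₁.cons ?_ ?_ (by simp)
    · by_cases hsl : s = .length
      · subst hsl
        simp [step_cfg, program, hl]
      · simp [step_cfg, program, hl, hsl]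
    · congr 1
      funext r
      by_cases hr : r = s
      · by_cases hsl : s = .length <;> simp [hr, incrementBits, hsl]
      · simp [Function.update_apply, hr]
  | cons b l ih =>
    cases b with
    | false =>
      have h₁ := steps_back (μ := μ) (e₀ := e₀) (e₁ := e₁) (k := k) s hs false
        (Function.update S s (true :: l)) j (by simp [hs.symm, h])
      refine h₁.cons ?_ ?_ (by rw [List.length_cons]; omega)
      · simp [step_cfg, program, hl]
      · congr 1
        funext r
        by_cases hr : r = s
        · simp [hr, incrementBits]
        · simp [Function.update_apply, hr]
    | true =>
      have h₁ := ih (Function.update (Function.update S s l) aux (List.replicate (j + 1) false))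
        (j + 1) (by simp) (by simp [hs])
      refine h₁.cons ?_ ?_ (by rw [List.length_cons]; omega)
      · simp [step_cfg, program, hl, hs.symm, h, List.replicate_succ]
      · congr 1
        funext r
        by_cases hr : r = s
        · simp [hr, incrementBits, List.replicate_succ']
        · simp [Function.update_apply, hr]

/-- The number of steps taken by an increment. -/
theorem steps_increment (s : WorkStack) (hs : s ≠ aux) (S : WorkStack → List Bool)
    (h : S aux = []) :
    Steps e₀ e₁ k (2 * (S s).length + 2) (cfg (carry s) μ S)
      (cfg (afterIncrement s ((S s).all id)) μ
        (Function.update S s (incrementBits (s = .length) (S s)))) := by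
  have h' := steps_carry (μ := μ) (e₀ := e₀) (e₁ := e₁) (k := k) s hs S 0 (by simp [h]) _ rfl
  rwa [← h, Function.update_eq_self, List.replicate_zero, List.nil_append, zero_add] at h'

theorem steps_increment_lowBits (s : WorkStack) (hs : s ≠ aux) (hs' : s ≠ .length)
    (S : WorkStack → List Bool) (h : S aux = []) (n v : ℕ) (hv : S s = lowBits n v) :
    Steps e₀ e₁ k (2 * n + 2) (cfg (carry s) μ S)
      (cfg (afterIncrement s (2 ^ n ∣ v + 1)) μ (Function.update S s (lowBits n (v + 1)))) := by
  have h' := steps_increment (μ := μ) (e₀ := e₀) (e₁ := e₁) (k := k) s hs S h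
  rw [hv, length_lowBits, decide_eq_false hs', ← lowBits_succ] at h'
  convert h'
  rw [Bool.eq_iff_iff, all_lowBits, decide_eq_true_iff]

/-! ### Decoding the length of the input -/

theorem steps_copy (i : ℕ) :
    Steps e₀ e₁ k (t.length * (2 * (i + t.length) + 3) + 1)
      (cfg copy μ (layout t d b [] i.bits m u q))
      (cfg reverse μ (layout [] (t.reverse ++ d) b [] (i + t.length).bits m u q)) := by
  induction t generalizing i d with
  | nil => exact (ReachesIn.single (by simp [step_cfg, program])).mono (by simp)
  | cons c t ih =>
    have h₁ : Steps e₀ e₁ k 1 (cfg copy μ (layout (c :: t) d b [] i.bits m u q))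
        (cfg (carry .length) μ (layout t (c :: d) b [] i.bits m u q)) :=
      ReachesIn.single (by simp [step_cfg, program])
    have h₂ := steps_increment (μ := μ) (e₀ := e₀) (e₁ := e₁) (k := k) .length (by decide)
      (layout t (c :: d) b [] i.bits m u q) rfl
    simp only [layout_length, decide_true, ← bits_succ, update_layout_length] at h₂
    have h₃ := (h₁.trans h₂).trans (ih (c :: d) (i + 1))
    have h₄ := length_bits_le i
    rw [List.reverse_cons, List.append_assoc, List.singleton_append, List.length_cons,
      show i + (t.length + 1) = i + 1 + t.length by ring]
    exact h₃.mono (by nlinarith)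

theorem steps_reverse :
    Steps e₀ e₁ k (l.length + 1) (cfg reverse μ (layout t d b a l m u q))
      (cfg skipOne μ (layout t d b (l.reverse ++ a) [] m u q)) := by
  induction l generalizing a with
  | nil => exact ReachesIn.single (by simp [step_cfg, program])
  | cons c l ih =>
    refine (ih (c :: a)).cons ?_ ?_ (by simp)
    · simp [step_cfg, program]
    · simp

theorem steps_skipOne :
    Steps e₀ e₁ k 1 (cfg skipOne μ (layout t d b a l m u q))
      (cfg skipZeros μ (layout t d b a.tail l m u q)) := by
  refine ReachesIn.single ?_
  cases a <;> simp [step_cfg, program]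

theorem steps_skipZeros :
    Steps e₀ e₁ k (a.length + 1) (cfg skipZeros μ (layout t d b a l m u q))
      (cfg setup μ (layout t d b (afterOne a) l m u q)) := by
  induction a with
  | nil => exact ReachesIn.single (by simp [step_cfg, program, afterOne])
  | cons c a ih =>
    cases c with
    | true => exact (ReachesIn.single (by simp [step_cfg, program, afterOne])).mono (by simp)
    | false => exact (ReachesIn.head (by simp [step_cfg, program]) ih).mono (by simp)

/-- One pass over the advice also fixes the widths of the counters: each of its bits adds a zero to
the query and `k` zeros to the timer, which then counts up to `2 ^ (k n)`. -/
theorem steps_setup :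
    Steps e₀ e₁ k (a.length + 1) (cfg setup μ (layout t d b a l m u q))
      (cfg (rewind none) μ (layout t d b [] l (List.replicate (k * a.length) false ++ m)
        (a.reverse ++ u) (List.replicate a.length false ++ q))) := by
  induction a generalizing m u q with
  | nil => exact ReachesIn.single (by simp [step_cfg, program])
  | cons c a ih =>
    refine (ih (List.replicate k false ++ m) (c :: u) (false :: q)).cons ?_ ?_ (by simp)
    · simp [step_cfg, program, stepAux_pushBits]
    · congr 2
      · rw [List.length_cons, mul_add, mul_one, List.replicate_add, List.append_assoc]
      · simp
      · simp [List.replicate_succ']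

theorem steps_rewind (o : Option WorkStack) :
    Steps e₀ e₁ k (d.length + 1) (cfg (rewind o) μ (layout t d b a l m u q))
      (cfg (o.elim blockStart carry) μ (layout (d.reverse ++ t) [] b a l m u q)) := by
  induction d generalizing t with
  | nil => exact ReachesIn.single (by simp [step_cfg, program])
  | cons c d ih =>
    refine (ih (c :: t)).cons ?_ ?_ (by simp)
    · simp [step_cfg, program]
    · simp

/-- The number of steps taken to decode the length of the input. -/
theorem steps_decode :
    Steps e₀ e₁ k (t.length * (2 * t.length + 3) + 4 * t.length + 6)
      (cfg copy μ (layout t [] [] [] [] [] [] []))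
      (cfg blockStart μ (layout t [] [] [] []
        (lowBits (k * (advice t.length).length) 0) (advice t.length)
        (lowBits (advice t.length).length 0))) := by
  have h₁ := steps_copy (e₀ := e₀) (e₁ := e₁) (k := k) (μ := μ) t [] [] [] [] [] 0
  rw [Nat.zero_bits, zero_add] at h₁
  have h₂ := (((h₁.trans (steps_reverse ..)).trans (steps_skipOne ..)).trans
    (steps_skipZeros ..)).trans (steps_setup ..)
  have h₃ := h₂.trans (steps_rewind ..)
  simp only [List.append_nil, List.reverse_reverse] at h₃
  have h₄ := length_bits_le t.length
  have h₅ := length_afterOne_le t.length.bits.reverse.tail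
  rw [List.length_tail, List.length_reverse] at h₃ h₅
  rw [lowBits_zero, lowBits_zero, advice, List.length_reverse]
  refine h₃.mono ?_
  rw [List.length_reverse]
  omega

end Census

/-! ### Counter wrap-around and the recursion over blocks -/

theorem lowBits_two_pow (n : ℕ) : lowBits n (2 ^ n) = lowBits n 0 := by
  induction n with
  | zero => rfl
  | succ n ih =>
    have h₁ : (2 ^ (n + 1)).bodd = false := by simp [pow_succ]
    have h₂ : (2 ^ (n + 1)).div2 = 2 ^ n := by rw [Nat.div2_val, pow_succ]; omega
    simp only [lowBits, h₁, h₂, ih, Nat.bodd_zero, Nat.div2_zero]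

theorem not_hitsBlock_nil (p : List Bool → Bool) (m : ℕ) : ¬ HitsBlock p m [] := by
  rintro ⟨i, hi, -⟩
  simp at hi

theorem hitsBlock_iff (p : List Bool → Bool) (m : ℕ) {t : List Bool} (ht : t ≠ []) :
    HitsBlock p m t ↔ p (firstBlock m t) = true ∨ HitsBlock p m (t.drop m) := by
  constructor
  · rintro ⟨i, hi, h⟩
    cases i with
    | zero => exact Or.inl (by simpa using h)
    | succ i =>
      rw [add_one_mul] at hi h
      refine Or.inr ⟨i, ?_, ?_⟩
      · rw [List.length_drop]; omega
      · rw [List.drop_drop, add_comm m]; exact h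
  · rintro (h | ⟨i, hi, h⟩)
    · exact ⟨0, by simpa using List.length_pos_iff.2 ht, by simpa using h⟩
    · rw [List.length_drop] at hi
      rw [List.drop_drop, add_comm m] at h
      exact ⟨i + 1, by rw [add_one_mul]; omega, by rw [add_one_mul]; exact h⟩

namespace Census

open WorkStack WorkLabel TM2.Stmt

variable {M : FinTM2} {e₀ : M.Γ M.k₀ ≃ Bool ⊕ Bool} {e₁ : M.Γ M.k₁ ≃ Bool} {k : ℕ}
variable {μ : ∀ i, List (M.Γ i)} (t d b a l m u q x : List Bool)

/-! ### Running the subroutine on a block -/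

/-- The timer stands at `i`, and its overflow after `r + 1` more symbols ends the block. It wraps
around to zero, ready for the next block. -/
theorem steps_readSymbol (p i r : ℕ) (h : i + (r + 1) = 2 ^ p) :
    Steps e₀ e₁ k ((r + 1) * (2 * p + 3)) (cfg readSymbol μ (layout t d b [] l (lowBits p i) u q))
      (cfg feedBlock μ (layout (t.drop (r + 1)) ((t.take (r + 1)).reverse ++ d)
        ((firstBlock (r + 1) t).reverse ++ b) [] l (lowBits p 0) u q)) := by
  induction r generalizing i t d b with
  | zero =>
    have h₂ := steps_increment_lowBits (μ := μ) (e₀ := e₀) (e₁ := e₁) (k := k) time (by decide)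
      (by decide) (layout t.tail ((t.take 1).reverse ++ d) (t.head?.getD false :: b) []
        l (lowBits p i) u q) rfl p i rfl
    refine h₂.cons ?_ ?_ (by omega)
    · cases t <;> simp [step_cfg, program]
    · rw [zero_add] at h
      have hd : 2 ^ p ∣ i + 1 := by rw [h]
      rw [decide_eq_true hd, h, lowBits_two_pow]
      simp [afterIncrement]
  | succ r ih =>
    have h₂ := steps_increment_lowBits (μ := μ) (e₀ := e₀) (e₁ := e₁) (k := k) time (by decide)
      (by decide) (layout t.tail ((t.take 1).reverse ++ d) (t.head?.getD false :: b) []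
        l (lowBits p i) u q) rfl p i rfl
    have hd : ¬ 2 ^ p ∣ i + 1 := fun hd => by
      have := Nat.le_of_dvd (by omega) hd
      omega
    rw [decide_eq_false hd] at h₂
    simp only [update_layout_time] at h₂
    refine (h₂.trans (ih t.tail _ _ (i + 1) (by omega))).cons ?_ ?_ (by nlinarith)
    · cases t <;> simp [step_cfg, program]
    · cases t <;> simp

theorem steps_feedBlock (w : List (M.Γ M.k₀)) :
    Steps e₀ e₁ k (b.length + 1)
      (cfg feedBlock (Function.update nothing M.k₀ w) (layout t d b a l m u q))
      (cfg saveQuery (Function.update nothing M.k₀ ((b.reverse.map fun c => e₀.symm (.inr c)) ++ w))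
        (layout t d [] a l m u q)) := by
  induction b generalizing w with
  | nil => exact ReachesIn.single (by simp [step_cfg, program])
  | cons c b ih =>
    refine (ih (e₀.symm (.inr c) :: w)).cons ?_ ?_ (by simp)
    · simp [step_cfg, program]
    · simp

theorem steps_saveQuery :
    Steps e₀ e₁ k (q.length + 1) (cfg saveQuery μ (layout t d b a l m u q))
      (cfg feedQuery μ (layout t d b (q.reverse ++ a) l m u [])) := by
  induction q generalizing a with
  | nil => exact ReachesIn.single (by simp [step_cfg, program])
  | cons c q ih =>
    refine (ih (c :: a)).cons ?_ ?_ (by simp)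
    · simp [step_cfg, program]
    · simp

theorem lift_initList (S : WorkStack → List Bool) (w : List (M.Γ M.k₀)) :
    lift S (initList M w) =
      ⟨some (Sum.inr M.main), (M.initialState, none), join (Function.update nothing M.k₀ w) S⟩ := by
  simp only [lift, initList, Option.elim_some]
  congr 2
  funext i
  by_cases h : i = M.k₀
  · subst h; simp
  · simp [h]

theorem lift_haltList (S : WorkStack → List Bool) (w : List (M.Γ M.k₁)) :
    lift S (haltList M w) = cfg ret (Function.update nothing M.k₁ w) S := by
  simp only [lift, haltList, Option.elim_none, cfg]
  congr 2
  funext i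
  by_cases h : i = M.k₁
  · subst h; simp
  · simp [h]

theorem steps_feedQuery (w : List (M.Γ M.k₀)) :
    Steps e₀ e₁ k (a.length + 1)
      (cfg feedQuery (Function.update nothing M.k₀ w) (layout t d b a l m u q))
      (lift (layout t d b [] l m u (a.reverse ++ q))
        (initList M ((a.reverse.map fun c => e₀.symm (.inl c)) ++ w))) := by
  induction a generalizing w q with
  | nil =>
    refine ReachesIn.single ?_
    rw [lift_initList]
    simp [step_cfg, program]
  | cons c a ih =>
    refine (ih (c :: q) (e₀.symm (.inl c) :: w)).cons ?_ ?_ (by simp)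
    · simp [step_cfg, program]
    · simp

theorem stepAux_ret (S : WorkStack → List Bool) :
    TM2.stepAux (program e₀ e₁ k ret) (M.initialState, none) (join μ S) =
      TM2.stepAux (((μ M.k₁).head?.map e₁).elim (jump blockStart)
        fun b => if b then jump (rewind (some deficit)) else jump blockStart)
        (M.initialState, none) (join (Function.update μ M.k₁ (μ M.k₁).tail) S) := by
  rw [← stepAux_branchBit, ← update_join_inl]
  rfl

/-- A halting configuration has the initial state and empty stacks apart from the output, so popping
the answer leaves the subroutine ready to be run again. -/
theorem steps_ret (c : Bool) (S : WorkStack → List Bool) :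
    Steps e₀ e₁ k 1 (lift S (haltList M [e₁.symm c]))
      (cfg (if c then rewind (some deficit) else blockStart) nothing S) := by
  refine ReachesIn.single ?_
  rw [lift_haltList, step_cfg, stepAux_ret, Function.update_self, Function.update_idem,
    List.tail_cons, Function.update_eq_self_iff.2 rfl]
  cases c <;> simp

/-- The subroutine computes `V x y` within the given time, if `y` has the right length. -/
def Computes (e₀ : M.Γ M.k₀ ≃ Bool ⊕ Bool) (e₁ : M.Γ M.k₁ ≃ Bool) (k : ℕ)
    (V : List Bool → List Bool → Bool) (τ : ℕ → ℕ) : Prop :=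
  ∀ x y : List Bool, y.length = 2 ^ (k * x.length) →
    ReachesIn M.step (τ x.length)
      (initList M ((x.map fun c => e₀.symm (.inl c)) ++ y.map fun c => e₀.symm (.inr c)))
      (haltList M [e₁.symm (V x y)])

/-- A bound for the time spent on a block. -/
def blockTime (k : ℕ) (τ : ℕ → ℕ) (n : ℕ) : ℕ :=
  2 ^ (k * n) * (2 * (k * n) + 4) + 2 * n + τ n + 5

variable {V : List Bool → List Bool → Bool} {τ : ℕ → ℕ}

theorem steps_block (hV : Computes e₀ e₁ k V τ) (ht : t ≠ []) :
    Steps e₀ e₁ k (blockTime k τ x.length)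
      (cfg blockStart nothing (layout t d [] [] [] (lowBits (k * x.length) 0) u x))
      (cfg (if V x (firstBlock (2 ^ (k * x.length)) t) then rewind (some deficit) else blockStart)
        nothing (layout (t.drop (2 ^ (k * x.length)))
          ((t.take (2 ^ (k * x.length))).reverse ++ d) [] [] [] (lowBits (k * x.length) 0) u x)) := by
  obtain ⟨r, hr⟩ : ∃ r, r + 1 = 2 ^ (k * x.length) :=
    ⟨2 ^ (k * x.length) - 1, Nat.sub_add_cancel Nat.one_le_two_pow⟩
  have h₁ := steps_readSymbol (e₀ := e₀) (e₁ := e₁) (k := k) (μ := nothing) t d [] [] u x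
    (k * x.length) 0 r (by omega)
  rw [hr, List.append_nil] at h₁
  have h₂ := steps_feedBlock (e₀ := e₀) (e₁ := e₁) (k := k) (t.drop (2 ^ (k * x.length)))
    ((t.take (2 ^ (k * x.length))).reverse ++ d) (firstBlock (2 ^ (k * x.length)) t).reverse
    [] [] (lowBits (k * x.length) 0) u x []
  rw [Function.update_eq_self_iff.2 rfl, List.append_nil, List.reverse_reverse] at h₂
  have h₃ := ((h₁.trans h₂).trans (steps_saveQuery ..)).trans (steps_feedQuery ..)
  rw [List.append_nil, List.append_nil, List.reverse_reverse] at h₃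
  have h₄ := (h₃.trans (reachesIn_lift _ (hV x _ (by simp [List.takeD_length])))).trans
    (steps_ret ..)
  refine h₄.cons ?_ rfl ?_
  · cases t with
    | nil => exact absurd rfl ht
    | cons c t => simp [step_cfg, program]
  · simp only [List.length_reverse, List.takeD_length, blockTime]
    nlinarith

/-- The search stops at the first hit, so each input is counted at most once. How much text is then
left is irrelevant; it only matters that rewinding restores it. -/
theorem steps_blocks (hV : Computes e₀ e₁ k V τ) :
    ∃ t' d', d'.reverse ++ t' = d.reverse ++ t ∧
    Steps e₀ e₁ k (t.length * blockTime k τ x.length + 1)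
      (cfg blockStart nothing (layout t d [] [] [] (lowBits (k * x.length) 0) u x))
      (cfg (rewind (some (open Classical in
          if HitsBlock (V x) (2 ^ (k * x.length)) t then deficit else query)))
        nothing (layout t' d' [] [] [] (lowBits (k * x.length) 0) u x)) := by
  induction hn : t.length using Nat.strong_induction_on generalizing t d with
  | _ n ih =>
  by_cases ht : t = []
  · subst ht
    refine ⟨[], d, rfl, (ReachesIn.single ?_).mono (by omega)⟩
    simp [step_cfg, program, not_hitsBlock_nil]
  · have h₁ := steps_block (e₀ := e₀) (e₁ := e₁) t d u x hV ht
    have hlen := List.length_pos_iff.2 ht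
    rw [hitsBlock_iff _ _ ht]
    by_cases hx : V x (firstBlock (2 ^ (k * x.length)) t) = true
    · rw [if_pos hx] at h₁
      refine ⟨t.drop (2 ^ (k * x.length)), (t.take (2 ^ (k * x.length))).reverse ++ d, by simp, ?_⟩
      simp only [hx, true_or, if_true]
      exact h₁.mono (by nlinarith)
    · rw [if_neg hx] at h₁
      have hpos : 0 < 2 ^ (k * x.length) := by positivity
      obtain ⟨t', d', h', h₂⟩ := ih _ (by rw [List.length_drop]; omega)
        (t.drop (2 ^ (k * x.length))) ((t.take (2 ^ (k * x.length))).reverse ++ d) rfl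
      refine ⟨t', d', by simp [h'], ?_⟩
      rw [or_iff_right hx]
      refine (h₁.trans h₂).mono ?_
      rw [List.length_drop, hn]
      have : n - 2 ^ (k * x.length) + 1 ≤ n := by omega
      nlinarith

end Census

namespace Census

open WorkStack WorkLabel TM2.Stmt

variable {M : FinTM2} {e₀ : M.Γ M.k₀ ≃ Bool ⊕ Bool} {e₁ : M.Γ M.k₁ ≃ Bool} {k : ℕ}
variable {V : List Bool → List Bool → Bool} {τ : ℕ → ℕ}

/-! ### The loop over the queries -/

/-- The total length of the work stacks. -/
def totalLength (S : WorkStack → List Bool) : ℕ := (WorkStack.all.map fun s => (S s).length).sum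

theorem totalLength_update_tail {S : WorkStack → List Bool} {s : WorkStack} (hs : S s ≠ []) :
    totalLength (Function.update S s (S s).tail) < totalLength S := by
  have := List.length_pos_iff.2 hs
  cases s <;> simp [totalLength, WorkStack.all] <;> omega

theorem stepAux_drain (again last : CStmt M) (L : List WorkStack) (μ : ∀ i, List (M.Γ i))
    (S : WorkStack → List Bool) :
    (∀ s ∈ L, S s = []) ∧ TM2.stepAux (drain again last L) (M.initialState, none) (join μ S) =
        TM2.stepAux last (M.initialState, none) (join μ S) ∨
      ∃ S', totalLength S' < totalLength S ∧
        TM2.stepAux (drain again last L) (M.initialState, none) (join μ S) =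
          TM2.stepAux again (M.initialState, none) (join μ S') := by
  induction L with
  | nil => exact Or.inl ⟨by simp, rfl⟩
  | cons s L ih =>
    rw [drain, stepAux_popBit]
    cases hs : S s with
    | nil =>
      have : Function.update S s [] = S := Function.update_eq_self_iff.2 hs.symm
      simpa [this, hs] using ih
    | cons c l =>
      have := totalLength_update_tail (S := S) (s := s) (by simp [hs])
      exact Or.inr ⟨_, this, by simp [hs]⟩

/-- The output convention demands empty stacks apart from the answer. Each round of `drain` removes
a symbol until none is left. -/
theorem steps_clean (b : Bool) (μ : ∀ i, List (M.Γ i)) (S : WorkStack → List Bool) :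
    Steps e₀ e₁ k (totalLength S + 1) (cfg (clean b) μ S)
      ⟨none, (M.initialState, none), join μ (layout [b] [] [] [] [] [] [] [])⟩ := by
  induction hn : totalLength S using Nat.strong_induction_on generalizing S with
  | _ n ih =>
  rcases stepAux_drain (jump (clean b)) (pushBit text b halt) WorkStack.all μ S with
    ⟨h₁, h₂⟩ | ⟨S', h₁, h₂⟩
  · refine (ReachesIn.single ?_).mono (by omega)
    rw [step_cfg, program, h₂]
    obtain rfl : S = layout [] [] [] [] [] [] [] [] := by
      funext s
      rw [h₁ s (mem_all s)]
      cases s <;> rfl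
    simp
  · refine (ih _ (hn ▸ h₁) S' rfl).cons ?_ rfl (by omega)
    rw [step_cfg, program, h₂]
    rfl

/-- A bound for the time spent on a query, for an input of length `N`. -/
def queryTime (k : ℕ) (τ : ℕ → ℕ) (N n : ℕ) : ℕ :=
  N * blockTime k τ n + N + 4 * n + 6

theorem card_hitsFrom (V : List Bool → List Bool → Bool) (n m : ℕ) {v : ℕ} (t : List Bool)
    (hv : v < 2 ^ n) : (hitsFrom V n m v t).card = (hitsFrom V n m (v + 1) t).card +
      open Classical in if HitsBlock (V (lowBits n v)) m t then 1 else 0 := by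
  classical
  rw [hitsFrom, ← Finset.insert_Ico_add_one_left_eq_Ico hv, Finset.filter_insert]
  split_ifs with h
  · rw [Finset.card_insert_of_notMem (by simp)]
    simp only [hitsFrom]
  · simp only [hitsFrom, add_zero]

theorem steps_query (hV : Computes e₀ e₁ k V τ) (t u : List Bool) (n v : ℕ) :
    Steps e₀ e₁ k (t.length * blockTime k τ n + t.length + 2)
      (cfg blockStart nothing (layout t [] [] [] [] (lowBits (k * n) 0) u (lowBits n v)))
      (cfg (carry (open Classical in
        if HitsBlock (V (lowBits n v)) (2 ^ (k * n)) t then deficit else query)) nothing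
        (layout t [] [] [] [] (lowBits (k * n) 0) u (lowBits n v))) := by
  obtain ⟨t', d', h, h₁⟩ := steps_blocks (e₀ := e₀) (e₁ := e₁) t [] u (lowBits n v) hV
  rw [List.reverse_nil, List.nil_append] at h
  rw [length_lowBits] at h₁
  have h₂ := h₁.trans (steps_rewind ..)
  rw [h] at h₂
  refine h₂.mono ?_
  have : d'.length ≤ t.length := by rw [← h]; simp
  omega

/-- Invariant of the main loop: `v` is the current query and `w` the deficit plus the hits so far.
Overflow of `w` accepts early; overflow of `v` rejects, all queries having been tried. -/
theorem steps_queries (hV : Computes e₀ e₁ k V τ) (t : List Bool) (n v w r : ℕ)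
    (hv : v + (r + 1) = 2 ^ n) (hw : w < 2 ^ n) :
    ∃ S, totalLength S ≤ t.length + k * n + 2 * n ∧
    Steps e₀ e₁ k ((r + 1) * queryTime k τ t.length n)
      (cfg blockStart nothing
        (layout t [] [] [] [] (lowBits (k * n) 0) (lowBits n w) (lowBits n v)))
      (cfg (clean (decide (2 ^ n ≤ w + (hitsFrom V n (2 ^ (k * n)) v t).card))) nothing S) := by
  have hlen : ∀ w v, totalLength (layout t [] [] [] [] (lowBits (k * n) 0) (lowBits n w)
      (lowBits n v)) ≤ t.length + k * n + 2 * n := by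
    intro w v
    simp [totalLength, WorkStack.all]
    omega
  have hnext : ∀ w < 2 ^ n, ∃ S, totalLength S ≤ t.length + k * n + 2 * n ∧
      Steps e₀ e₁ k (r * queryTime k τ t.length n + 2 * n + 2)
        (cfg (carry query) nothing
          (layout t [] [] [] [] (lowBits (k * n) 0) (lowBits n w) (lowBits n v)))
        (cfg (clean (decide (2 ^ n ≤ w + (hitsFrom V n (2 ^ (k * n)) (v + 1) t).card)))
          nothing S) := by
    intro w hw
    have h₂ := steps_increment_lowBits (μ := nothing) (e₀ := e₀) (e₁ := e₁) (k := k) query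
      (by decide) (by decide)
      (layout t [] [] [] [] (lowBits (k * n) 0) (lowBits n w) (lowBits n v)) rfl n v rfl
    rw [update_layout_query] at h₂
    cases r with
    | zero =>
      rw [zero_add] at hv
      rw [hv, decide_eq_true dvd_rfl] at h₂
      refine ⟨_, hlen w (2 ^ n), ?_⟩
      -- No queries remain, and `w < 2 ^ n`.
      have : decide (2 ^ n ≤ w + (hitsFrom V n (2 ^ (k * n)) (v + 1) t).card) = false := by
        rw [hv]
        simpa [hitsFrom] using hw
      rw [this]
      exact h₂.mono (by omega)
    | succ r =>
      have hd : ¬ 2 ^ n ∣ v + 1 := fun hd => by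
        have := Nat.le_of_dvd (by omega) hd
        omega
      rw [decide_eq_false hd] at h₂
      obtain ⟨S, hS, h₃⟩ := steps_queries hV t n (v + 1) w r (by omega) hw
      exact ⟨S, hS, (h₂.trans h₃).mono (by omega)⟩
  have h₁ := steps_query (e₀ := e₀) (e₁ := e₁) hV t (lowBits n w) n v
  rw [card_hitsFrom V n _ t (by omega)]
  have htime : (r + 1) * queryTime k τ t.length n =
      r * queryTime k τ t.length n + (t.length * blockTime k τ n + t.length + 2) +
        (4 * n + 4) := by
    rw [add_one_mul]
    nth_rewrite 2 [queryTime]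
    ring
  rw [htime]
  by_cases hit : HitsBlock (V (lowBits n v)) (2 ^ (k * n)) t
  · simp only [hit, if_true] at h₁ ⊢
    have h₂ := steps_increment_lowBits (μ := nothing) (e₀ := e₀) (e₁ := e₁) (k := k) deficit
      (by decide) (by decide)
      (layout t [] [] [] [] (lowBits (k * n) 0) (lowBits n w) (lowBits n v)) rfl n w rfl
    rw [update_layout_deficit] at h₂
    by_cases hw' : w + 1 = 2 ^ n
    · rw [hw', decide_eq_true dvd_rfl] at h₂
      refine ⟨_, hlen (2 ^ n) v, ?_⟩
      rw [decide_eq_true (by omega)]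
      exact (h₁.trans h₂).mono (by omega)
    · have hd : ¬ 2 ^ n ∣ w + 1 := fun hd => by
        have := Nat.le_of_dvd (by omega) hd
        omega
      rw [decide_eq_false hd] at h₂
      obtain ⟨S, hS, h₃⟩ := hnext (w + 1) (by omega)
      refine ⟨S, hS, ?_⟩
      rw [show ∀ c, w + (c + 1) = w + 1 + c by intro c; omega]
      exact ((h₁.trans h₂).trans h₃).mono (by omega)
  · simp only [hit, if_false, add_zero] at h₁ ⊢
    obtain ⟨S, hS, h₃⟩ := hnext w hw
    exact ⟨S, hS, (h₁.trans h₃).mono (by omega)⟩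

/-! ### The running time -/

/-- A bound for the running time of the census machine. -/
noncomputable def timePolynomial (k a : ℕ) : Polynomial ℕ :=
  let s : Polynomial ℕ := Polynomial.X + 1
  s * (2 * s + 3) + 4 * s + 6 +
    s * (s * (s ^ k * (2 * (Polynomial.C k * s) + 4) + 2 * s + Polynomial.C a * s ^ a + 5) +
      s + 4 * s + 6) + (s + Polynomial.C k * s + 2 * s + 1)

theorem steps_machine {a : ℕ} (hV : Computes e₀ e₁ k V fun n => a * 2 ^ (a * n))
    (t : List Bool) :
    Steps e₀ e₁ k ((timePolynomial k a).eval t.length)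
      (cfg copy nothing (layout t [] [] [] [] [] [] []))
      ⟨none, (M.initialState, none),
        join nothing (layout [censusProperty V k t] [] [] [] [] [] [] [])⟩ := by
  have h₁ := steps_decode (e₀ := e₀) (e₁ := e₁) (k := k) (μ := nothing) t
  obtain ⟨n, hn⟩ : ∃ n, n = (advice t.length).length := ⟨_, rfl⟩
  obtain ⟨w, hw⟩ : ∃ w, w = bitsValue (advice t.length) := ⟨_, rfl⟩
  have hu : advice t.length = lowBits n w := by rw [hn, hw, lowBits_bitsValue]
  have hwn : w < 2 ^ n := by rw [hn, hw]; exact bitsValue_lt _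
  obtain ⟨r, hr⟩ : ∃ r, r + 1 = 2 ^ n := ⟨2 ^ n - 1, Nat.sub_add_cancel Nat.one_le_two_pow⟩
  obtain ⟨S, hS, h₂⟩ := steps_queries hV t n 0 w r (by omega) hwn
  rw [← hn, hu] at h₁
  have h₃ := (h₁.trans h₂).trans (steps_clean ..)
  have hP : decide (2 ^ n ≤ w + (hitsFrom V n (2 ^ (k * n)) 0 t).card) =
      censusProperty V k t := by
    rw [hw, hn, censusProperty]
  rw [hP] at h₃
  refine h₃.mono ?_
  rw [hr]
  -- The variable `s` of `timePolynomial` stands for `t.length + 1`: it bounds `2 ^ n` and `n`, and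
  -- its powers bound `2 ^ (k * n)` and `2 ^ (a * n)`.
  have h2n : 2 ^ n ≤ t.length + 1 := hn ▸ two_pow_length_advice_le t.length
  have hns : n ≤ t.length + 1 := Nat.lt_two_pow_self.le.trans h2n
  have hpow : ∀ c, 2 ^ (c * n) ≤ (t.length + 1) ^ c := fun c => by
    rw [mul_comm, pow_mul]
    exact Nat.pow_le_pow_left h2n c
  have hk := hpow k
  have ha := hpow a
  simp only [timePolynomial, Polynomial.eval_add, Polynomial.eval_mul, Polynomial.eval_pow,
    Polynomial.eval_X, Polynomial.eval_one, Polynomial.eval_C, Polynomial.eval_ofNat]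
  simp only [queryTime, blockTime]
  have hS' : totalLength S + 1 ≤ t.length + 1 + k * (t.length + 1) + 2 * (t.length + 1) + 1 := by
    have := Nat.mul_le_mul_left k hns
    omega
  refine add_le_add (add_le_add ?_ ?_) hS'
  · gcongr <;> omega
  · gcongr <;> omega

theorem initList_machine (t : List Bool) :
    initList (machine M e₀ e₁ k) t = cfg copy nothing (layout t [] [] [] [] [] [] []) := by
  unfold initList cfg
  congr 1
  funext i
  rcases i with i | s
  · rfl
  · cases s <;> rfl

theorem haltList_machine (t : List Bool) :
    haltList (machine M e₀ e₁ k) t = (⟨none, (M.initialState, none),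
        join nothing (layout t [] [] [] [] [] [] [])⟩ : CCfg M) := by
  unfold haltList
  congr 1
  funext i
  rcases i with i | s
  · rfl
  · cases s <;> rfl

end Census

/-! ### Polynomial-time decidability -/

theorem isPolyTimeProperty_censusProperty {V : List Bool → List Bool → Bool} {k : ℕ}
    (hV : RunsInExpTime V k) : IsPolyTimeProperty (censusProperty V k) := by
  obtain ⟨M, a, h⟩ := hV
  have hc : Census.Computes M.inputAlphabet M.outputAlphabet k V fun n => a * 2 ^ (a * n) := by
    intro x y hy
    obtain ⟨h⟩ := h x y hy
    refine ⟨h.steps, h.steps_le_m, ?_⟩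
    have h' := h.evals_in_steps
    simpa [Computability.encodingProd, Computability.encodingList, Computability.encodeBool,
      Function.comp_def] using h'
  refine ⟨{
    tm := Census.machine M.tm M.inputAlphabet M.outputAlphabet k
    inputAlphabet := Equiv.refl Bool
    outputAlphabet := Equiv.refl Bool
    time := Census.timePolynomial k a
    outputsFun := fun t => Classical.choice ?_ }⟩
  obtain ⟨s, hs, h'⟩ := Census.steps_machine hc t
  refine ⟨⟨⟨s, ?_⟩, hs⟩⟩
  have h₁ : (List.map (Equiv.refl Bool).invFun ((Computability.encodingList Bool).encode t)) = t :=
    List.map_id _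
  have h₂ : List.map (Equiv.refl Bool).invFun (Computability.encodeBool (censusProperty V k t)) =
    [censusProperty V k t] := rfl
  erw [h₁, h₂, Census.initList_machine, Option.map_some, Census.haltList_machine]
  exact h'

/-! ### Lengths encoding a bit string -/

theorem bitsValue_append (l l' : List Bool) :
    bitsValue (l ++ l') = bitsValue l + 2 ^ l.length * bitsValue l' := by
  induction l with
  | nil => simp [bitsValue]
  | cons b l ih =>
    simp only [List.cons_append, bitsValue, ih, Nat.bit_val, List.length_cons, pow_succ]
    ring

theorem bits_bitsValue (l : List Bool) : (bitsValue (l ++ [true])).bits = l ++ [true] := by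
  induction l with
  | nil => rfl
  | cons b l ih =>
    rw [List.cons_append, bitsValue, Nat.bits_append_bit, ih]
    intro h
    rw [h, Nat.zero_bits] at ih
    simp at ih

/-- A number whose binary expansion encodes the string `u`, with `r` padding bits. -/
def adviceLength (u : List Bool) (r : ℕ) : ℕ :=
  bitsValue (u ++ true :: List.replicate r false ++ [true])

theorem afterOne_replicate (r : ℕ) (l : List Bool) :
    afterOne (List.replicate r false ++ true :: l) = l := by
  induction r with
  | zero => rfl
  | succ r ih => simpa [List.replicate_succ, afterOne] using ih

theorem advice_adviceLength (u : List Bool) (r : ℕ) : advice (adviceLength u r) = u := by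
  rw [advice, adviceLength, bits_bitsValue]
  simp [afterOne_replicate]

theorem adviceLength_eq (u : List Bool) (r : ℕ) :
    adviceLength u r = bitsValue u + 2 ^ u.length + 2 ^ (u.length + r + 1) := by
  have h : bitsValue (List.replicate r false ++ [true]) = 2 ^ r := by
    rw [bitsValue_append, ← lowBits_zero, bitsValue_lowBits (by positivity)]
    simp [bitsValue]
  rw [adviceLength, List.append_assoc, List.cons_append, bitsValue_append, bitsValue, h,
    Nat.bit_val]
  simp
  ring

theorem two_pow_lt_adviceLength (u : List Bool) (r : ℕ) :
    2 ^ (u.length + r + 1) < adviceLength u r := by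
  rw [adviceLength_eq]
  have : 0 < 2 ^ u.length := by positivity
  omega

/-- The second one in the expansion keeps the length strictly above a power of two, so rounding up
gives the full number of binary digits. -/
theorem clog_adviceLength (u : List Bool) (r : ℕ) :
    Nat.clog 2 (adviceLength u r) = u.length + r + 2 := by
  have h₁ := two_pow_lt_adviceLength u r
  refine le_antisymm (Nat.clog_le_of_le_pow ?_) ((Nat.lt_clog_iff_pow_lt (by norm_num)).2 h₁)
  have h₂ := bitsValue_lt (u ++ true :: List.replicate r false ++ [true])
  refine h₂.le.trans (le_of_eq ?_)
  congr 1
  simp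
  omega

/-! ### Fractions of accepted strings -/

theorem acceptFraction_nonneg (ℓ : ℕ) (p : List Bool → Bool) : 0 ≤ acceptFraction ℓ p := by
  unfold acceptFraction
  positivity

theorem acceptFraction_not (ℓ : ℕ) (p : List Bool → Bool) :
    acceptFraction ℓ (fun t => !p t) = 1 - acceptFraction ℓ p := by
  have h := Finset.card_filter_add_card_filter_not (s := (Finset.univ : Finset (Fin ℓ → Bool)))
    (fun y => p (List.ofFn y) = true)
  rw [Finset.card_univ, Fintype.card_fun, Fintype.card_bool, Fintype.card_fin] at h
  have h' : (((Finset.univ.filter fun y : Fin ℓ → Bool => p (List.ofFn y) = true).card : ℚ) +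
    (Finset.univ.filter fun y : Fin ℓ → Bool => ¬ p (List.ofFn y) = true).card) = 2 ^ ℓ := by
    exact_mod_cast h
  unfold acceptFraction
  rw [eq_sub_iff_add_eq, ← add_div, div_eq_one_iff_eq (by positivity), ← h', add_comm]
  simp

/-- Independence of disjoint parts of a random string. -/
theorem acceptFraction_add (m n : ℕ) (p q : List Bool → Bool) :
    acceptFraction (m + n) (fun t => p (t.take m) && q (t.drop m)) =
      acceptFraction m p * acceptFraction n q := by
  unfold acceptFraction
  rw [div_mul_div_comm, ← pow_add, ← Nat.cast_mul, ← Finset.card_product]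
  congr 2
  refine (Finset.card_equiv (Fin.appendEquiv m n) ?_).symm
  rintro ⟨f, g⟩
  simp [Fin.appendEquiv, List.ofFn_fin_append]

theorem acceptFraction_le_sum {ι : Type*} (ℓ : ℕ) (s : Finset ι) (p : List Bool → Bool)
    (q : ι → List Bool → Bool)
    (h : ∀ t : List Bool, t.length = ℓ → p t = true → ∃ i ∈ s, q i t = true) :
    acceptFraction ℓ p ≤ ∑ i ∈ s, acceptFraction ℓ (q i) := by
  classical
  unfold acceptFraction
  rw [← Finset.sum_div]
  gcongr
  rw [← Nat.cast_sum]
  refine Nat.cast_le.2 ((Finset.card_le_card ?_).trans Finset.card_biUnion_le)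
  intro y hy
  simpa using h _ (by simp) (by simpa using hy)

/-- None of the first `m` blocks of length `b` of a string is accepted. -/
def missesBlocks (p : List Bool → Bool) (b : ℕ) : ℕ → List Bool → Bool
  | 0, _ => true
  | m + 1, t => !p (t.take b) && missesBlocks p b m (t.drop b)

theorem acceptFraction_missesBlocks_le (p : List Bool → Bool) (b m r : ℕ) :
    acceptFraction (m * b + r) (missesBlocks p b m) ≤ (1 - acceptFraction b p) ^ m := by
  induction m with
  | zero => simp [acceptFraction, missesBlocks]
  | succ m ih =>
    rw [show (m + 1) * b + r = b + (m * b + r) by ring, pow_succ']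
    refine (acceptFraction_add b _ (fun t => !p t) _).le.trans ?_
    rw [acceptFraction_not]
    refine mul_le_mul_of_nonneg_left ih ?_
    rw [← acceptFraction_not]
    exact acceptFraction_nonneg _ _

theorem missesBlocks_of_not_hitsBlock {p : List Bool → Bool} {b : ℕ} (hb : 0 < b) {m : ℕ}
    {t : List Bool} (ht : m * b ≤ t.length) (h : ¬ HitsBlock p b t) :
    missesBlocks p b m t = true := by
  induction m generalizing t with
  | zero => rfl
  | succ m ih =>
    rw [add_one_mul] at ht
    have hne : t ≠ [] := by
      rintro rfl
      simp at ht
      omega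
    rw [hitsBlock_iff _ _ hne, not_or, firstBlock, List.takeD_eq_take _ (by omega)] at h
    simp only [missesBlocks, Bool.and_eq_true, Bool.not_eq_true', ← Bool.not_eq_true]
    exact ⟨h.1, ih (by rw [List.length_drop]; omega) h.2⟩

/-! ### The census -/

/-- The numbers whose `n` bits are a string in the language `L`. -/
noncomputable def census (L : Language Bool) (n : ℕ) : Finset ℕ :=
  open Classical in (Finset.range (2 ^ n)).filter fun v => lowBits n v ∈ L

theorem mem_census {L : Language Bool} {n v : ℕ} :
    v ∈ census L n ↔ v < 2 ^ n ∧ lowBits n v ∈ L := by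
  simp [census]

theorem card_census_le (L : Language Bool) (n : ℕ) : (census L n).card ≤ 2 ^ n := by
  classical
  simpa [census] using Finset.card_filter_le (Finset.range (2 ^ n)) fun v => lowBits n v ∈ L

theorem mem_hitsFrom {V : List Bool → List Bool → Bool} {n m v w : ℕ} {t : List Bool} :
    w ∈ hitsFrom V n m v t ↔ (v ≤ w ∧ w < 2 ^ n) ∧ HitsBlock (V (lowBits n w)) m t := by
  simp [hitsFrom]

theorem bitsValue_mem_census {L : Language Bool} {x : List Bool} (hx : x ∈ L) :
    bitsValue x ∈ census L x.length := by
  simp [mem_census, bitsValue_lt, lowBits_bitsValue, hx]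

section census

variable {V : List Bool → List Bool → Bool} {L : Language Bool} {k n : ℕ}

/-- One-sided error; it applies to the last block too, since padding gives it the length that
soundness requires. -/
theorem hitsFrom_subset_census (hV : IsRTimePredicate V L k) (t : List Bool) :
    hitsFrom V n (2 ^ (k * n)) 0 t ⊆ census L n := by
  intro v hv
  obtain ⟨⟨-, hv⟩, i, -, hi⟩ := mem_hitsFrom.1 hv
  refine mem_census.2 ⟨hv, by_contra fun hL => ?_⟩
  rw [hV.sound _ hL _ (by simp [List.takeD_length])] at hi
  exact absurd hi (by simp)

/-- On the lengths that encode the right number, the census property holds precisely for the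
strings hitting all the inputs in the language. -/
theorem censusProperty_iff (hV : IsRTimePredicate V L k) (hL : (census L n).Nonempty)
    {t : List Bool} (ht : advice t.length = lowBits n (2 ^ n - (census L n).card)) :
    censusProperty V k t = true ↔
      ∀ v ∈ census L n, HitsBlock (V (lowBits n v)) (2 ^ (k * n)) t := by
  have hcard := card_census_le L n
  have hpos := hL.card_pos
  have hsub := hitsFrom_subset_census (n := n) hV t
  have h₁ : censusProperty V k t = true ↔ hitsFrom V n (2 ^ (k * n)) 0 t = census L n := by
    simp only [censusProperty, ht, length_lowBits, decide_eq_true_iff]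
    -- The deficit fits in `n` bits because the census is nonempty.
    rw [bitsValue_lowBits (by omega)]
    constructor
    · intro h
      exact Finset.eq_of_subset_of_card_le hsub (by omega)
    · intro h
      rw [h]
      omega
  rw [h₁]
  constructor
  · intro h v hv
    rw [← h] at hv
    exact (mem_hitsFrom.1 hv).2
  · intro h
    exact hsub.antisymm fun v hv =>
      mem_hitsFrom.2 ⟨⟨Nat.zero_le _, (mem_census.1 hv).1⟩, h v hv⟩

/-- A fixed input of the language is missed by `m ≥ n` independent blocks with probability at most
`3⁻ⁿ`; the union bound over at most `2ⁿ` inputs gives `(2/3)ⁿ ≤ 4/9`. -/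
theorem half_le_acceptFraction_censusProperty (hV : IsRTimePredicate V L k)
    (hL : (census L n).Nonempty) (hn : 2 ≤ n) {N m : ℕ} (hm : n ≤ m) (hN : m * 2 ^ (k * n) ≤ N)
    (ha : advice N = lowBits n (2 ^ n - (census L n).card)) :
    1 / 2 ≤ acceptFraction N (censusProperty V k) := by
  have hcard := card_census_le L n
  have h₁ : acceptFraction N (fun t => !censusProperty V k t) ≤
      ∑ v ∈ census L n, acceptFraction N (missesBlocks (V (lowBits n v)) (2 ^ (k * n)) m) := by
    refine acceptFraction_le_sum _ _ _ _ fun t ht h => ?_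
    rw [Bool.not_eq_true', ← Bool.not_eq_true, censusProperty_iff hV hL (by rw [ht, ha])] at h
    push Not at h
    obtain ⟨v, hv, h⟩ := h
    exact ⟨v, hv, missesBlocks_of_not_hitsBlock (by positivity) (by rw [ht]; exact hN) h⟩
  have h₂ : ∀ v ∈ census L n,
      acceptFraction N (missesBlocks (V (lowBits n v)) (2 ^ (k * n)) m) ≤ (1 / 3) ^ n := by
    intro v hv
    have hvL : lowBits n v ∈ L := (mem_census.1 hv).2
    have h₃ := hV.complete _ hvL
    rw [length_lowBits] at h₃
    obtain ⟨r, rfl⟩ := Nat.exists_eq_add_of_le hN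
    refine (acceptFraction_missesBlocks_le _ _ _ _).trans ?_
    have h₄ : 0 ≤ 1 - acceptFraction (2 ^ (k * n)) (V (lowBits n v)) := by
      rw [← acceptFraction_not]
      exact acceptFraction_nonneg _ _
    calc _ ≤ (1 / 3 : ℚ) ^ m := pow_le_pow_left₀ h₄ (by linarith) _
      _ ≤ _ := pow_le_pow_of_le_one (by norm_num) (by norm_num) hm
  have h₅ := h₁.trans (Finset.sum_le_card_nsmul _ _ _ h₂)
  have h₆ : (census L n).card • (1 / 3 : ℚ) ^ n ≤ 1 / 2 := by
    rw [nsmul_eq_mul]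
    calc _ ≤ (2 : ℚ) ^ n * (1 / 3) ^ n := by
          gcongr
          exact_mod_cast hcard
      _ = (2 / 3) ^ n := by rw [← mul_pow]; norm_num
      _ ≤ (2 / 3) ^ 2 := pow_le_pow_of_le_one (by norm_num) (by norm_num) hn
      _ ≤ 1 / 2 := by norm_num
  rw [acceptFraction_not] at h₅
  linarith

/-! ### Usefulness, and the choice of the length -/

theorem takeD_eq_take_append {α : Type*} (a : α) (m r : ℕ) (l : List α) (h : m ≤ l.length + r) :
    l.takeD m a = (l ++ List.replicate r a).take m := by
  induction m generalizing l r with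
  | zero => simp
  | succ m ih =>
    cases l with
    | nil =>
      rw [List.length_nil, zero_add] at h
      simp [h, List.replicate_succ]
    | cons b l =>
      rw [List.length_cons] at h
      simp [ih r l (by omega)]

/-- A function encoded by a string with the census property has a truth table that encodes a
hitting set. -/
theorem encodesHittingSet_truthTable (hV : IsRTimePredicate V L k) (hL : (census L n).Nonempty)
    {t : List Bool} (ha : advice t.length = lowBits n (2 ^ n - (census L n).card))
    (hP : censusProperty V k t = true) {m : ℕ}
    (hm : 2 ^ Nat.clog 2 t.length = m * 2 ^ (k * n))
    {f : (Fin (Nat.clog 2 t.length) → Bool) → Bool} (hf : IsEncodedBy t f) :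
    EncodesHittingSet V L k n m (truthTable f) := by
  have hlen : t.length ≤ 2 ^ Nat.clog 2 t.length := Nat.le_pow_clog (by norm_num) _
  refine ⟨by simp [truthTable, hm], ?_⟩
  rintro x hx rfl
  obtain ⟨i, hi, h⟩ := (censusProperty_iff hV hL ha).1 hP _ (bitsValue_mem_census hx)
  rw [lowBits_bitsValue] at h
  have him : i < m := lt_of_mul_lt_mul_right (hi.trans_le (hm ▸ hlen)) (Nat.zero_le _)
  refine ⟨_, ⟨i, him, ?_⟩, h⟩
  have hi' : (i + 1) * 2 ^ (k * x.length) ≤ m * 2 ^ (k * x.length) := Nat.mul_le_mul_right _ him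
  rw [hf, List.drop_append_of_le_length hi.le, firstBlock, takeD_eq_take_append]
  rw [List.length_drop]
  rw [add_one_mul] at hi'
  omega

end census

theorem hasCircuitOfSize_const (j : ℕ) (b : Bool) {s : ℕ} (hs : 1 ≤ s) :
    HasCircuitOfSize (fun _ : Fin j → Bool => b) s :=
  ⟨1, hs, .snoc .inputs (.const b), Fin.last j, fun x => by
    exact Fin.snoc_last (α := fun _ => Bool) ..⟩

theorem HasCircuitOfSize.mono {n s s' : ℕ} {f : (Fin n → Bool) → Bool}
    (h : HasCircuitOfSize f s) (hs : s ≤ s') : HasCircuitOfSize f s' := by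
  obtain ⟨t, ht, h⟩ := h
  exact ⟨t, ht.trans hs, h⟩

theorem mainTheorem12 (A : ℕ) (hA : 1 ≤ A)
    (h : ∀ c : ℕ, ¬ RTimeHasHittingSets (fun n => A * n ^ 2) c) :
    ∀ c : ℕ, ∃ P : List Bool → Bool, IsIoPNatural P c := by
  intro c
  -- The extra factor `n` absorbs the constant `(k + 2) ^ c` lost in passing from `n` to `⌈log₂ N⌉`.
  have hc := h (c + 1)
  unfold RTimeHasHittingSets at hc
  push Not at hc
  obtain ⟨V, L, k, hV, hfreq⟩ := hc
  refine ⟨censusProperty V k, isPolyTimeProperty_censusProperty hV.time, 1, ?_⟩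
  rw [Filter.frequently_atTop] at hfreq ⊢
  intro N₀
  obtain ⟨n, hn, hbad⟩ := hfreq (N₀ + 4 + (k + 2) ^ c)
  have hk := hV.pos
  -- If no input of length `n` were in the language, any block would do, and a constant circuit
  -- would yield a hitting set.
  have hL : (census L n).Nonempty := by
    by_contra hL
    rw [Finset.not_nonempty_iff_eq_empty] at hL
    refine hbad (k * n) (fun _ => false) (hasCircuitOfSize_const _ _ (Nat.one_le_pow _ _ (by omega)))
      1 (Nat.mul_pos hA (pow_pos (by omega) 2)) ⟨by simp [truthTable], ?_⟩
    rintro x hx rfl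
    have := bitsValue_mem_census hx
    rw [hL] at this
    simp at this
  obtain ⟨ℓ, hℓ⟩ : ∃ ℓ, Nat.clog 2 n = ℓ + 1 :=
    ⟨Nat.clog 2 n - 1, (Nat.sub_add_cancel (Nat.clog_pos (by norm_num) (by omega))).symm⟩
  have hℓ₁ : 2 ^ ℓ < n := by
    have := Nat.pow_pred_clog_lt_self (b := 2) (by norm_num) (x := n) (by omega)
    rwa [hℓ, Nat.pred_succ] at this
  have hℓ₂ : n ≤ 2 ^ (ℓ + 1) := hℓ ▸ Nat.le_pow_clog (by norm_num) _
  have hℓn : ℓ < n := Nat.lt_two_pow_self.trans hℓ₁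
  have hkn : n ≤ k * n := Nat.le_mul_of_pos_left n hk
  -- With `r + ℓ` padding zeros, the top bit of the length has weight `2 ^ (ℓ + 1)` blocks.
  obtain ⟨r, hr⟩ := Nat.exists_eq_add_of_le hkn
  obtain ⟨u, hu⟩ : ∃ u, u = lowBits n (2 ^ n - (census L n).card) := ⟨_, rfl⟩
  have hulen : u.length = n := by rw [hu, length_lowBits]
  have ha : advice (adviceLength u (r + ℓ)) = lowBits n (2 ^ n - (census L n).card) := by
    rw [advice_adviceLength, hu]
  have hlt := two_pow_lt_adviceLength u (r + ℓ)
  have hclog := clog_adviceLength u (r + ℓ)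
  rw [hulen, show n + (r + ℓ) + 1 = (ℓ + 1) + k * n by omega] at hlt
  rw [hulen, show n + (r + ℓ) + 2 = (ℓ + 2) + k * n by omega] at hclog
  have hnN : n ≤ adviceLength u (r + ℓ) := by
    refine le_trans ?_ hlt.le
    rw [pow_add]
    exact hℓ₂.trans (Nat.le_mul_of_pos_right _ (by positivity))
  refine ⟨adviceLength u (r + ℓ), by omega, ?_, ?_⟩
  · refine le_trans ?_ (half_le_acceptFraction_censusProperty hV hL (by omega) hℓ₂
      (by rw [← pow_add]; exact hlt.le) ha)
    rw [pow_one]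
    refine one_div_le_one_div_of_le (by norm_num) ?_
    exact_mod_cast (by omega : 2 ≤ adviceLength u (r + ℓ))
  · intro T hT hcirc
    by_contra hP
    rw [Bool.not_eq_false] at hP
    obtain ⟨f, hf, hs⟩ := hcirc
    refine hbad _ f (hs.mono ?_) (2 ^ (ℓ + 2)) ?_ (encodesHittingSet_truthTable hV hL
      (by rw [hT, ha]) hP (by rw [hT, hclog, pow_add]) hf)
    · rw [hclog]
      calc (ℓ + 2 + k * n) ^ c ≤ ((k + 2) * n) ^ c := by
            refine Nat.pow_le_pow_left ?_ c
            rw [add_mul]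
            omega
        _ = (k + 2) ^ c * n ^ c := mul_pow ..
        _ ≤ n * n ^ c := Nat.mul_le_mul_right _ (by omega)
        _ = n ^ (c + 1) := (pow_succ' ..).symm
    -- Rounding to powers of two costs a factor below 4, hence `n ≥ 4`; the quadratic bound leaves
    -- ample room.
    · calc 2 ^ (ℓ + 2) = 4 * 2 ^ ℓ := by ring
        _ ≤ n * n := Nat.mul_le_mul (by omega) hℓ₁.le
        _ = 1 * n ^ 2 := by ring
        _ ≤ A * n ^ 2 := Nat.mul_le_mul_right _ hA
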